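/- Let $A\in\mathbb{R}^{n\times n}$ be a symmetric matrix that is not positive definite, let $a,b\in\mathbb{R}^n$, $c\in\mathbb{R}$ and $\Delta>0$. Consider the extended trust region subproblem $$p^*=\min\{\,x^TAx-2a^Tx \;:\; x\in\mathbb{R}^n,\ \|x\|^2\le\Delta,\ b^Tx\le c\,\}\qquad\text{(eTRS)},$$ where $\|\cdot\|$ is the Euclidean norm, and assume the Slater condition: there is $\hat x$ with $\|\hat x\|^2<\Delta$ and $b^T\hat x<c$. Let $$d^*=\sup_{\lambda_1,\lambda_2\ge 0}\ \inf_{x\in\mathbb{R}^n}\ \bigl[x^TAx-2a^Tx+\lambda_1(\|x\|^2-\Delta)+\lambda_2(b^Tx-c)\bigr]$$ be the value of its Lagrangian dual, and say that strong duality holds for (eTRS) if $p^*=d^*$. Write $\lambda_{\min}(M)$ for the smallest eigenvalue of a symmetric matrix $M$. For $t,\lambda\in\mathbb{R}$ put $$D(t,\lambda)=\begin{bmatrix} t & (-a+\frac{\lambda}{2}b)^T\\ -a+\frac{\lambda}{2}b & A\end{bmatrix},\qquad k(t,\lambda)=(\Delta+1)\lambda_{\min}(D(t,\lambda))-t-\lambda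 c .$$ Let $(t^*,\lambda^*)$ be an optimal solution of the problem of maximizing $k(t,\lambda)$ over all $(t,\lambda)\in\mathbb{R}^2$ with $\lambda\ge 0$ and $\lambda_{\min}(D(t,\lambda))\le 0$. Then strong duality fails for (eTRS) if and only if both of the following hold: 1. $\lambda_{\min}(D(t^*,\lambda^*))=\lambda_{\min}(A)<0$ and $\lambda^*>0$; 2. $\lambda_{\min}(A)$ has multiplicity one, and the linear system $(A-\lambda_{\min}(A)I)x=a-\frac{\lambda^*}{2}b$ has two solutions $x_1,x_2$ with $x_1^Tx_1=x_2^Tx_2=\Delta$ and $(b^Tx_1-c)(b^Tx_2-c)<0$. -/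

import Mathlib

open scoped Matrix

namespace ETRS

/-- The smallest (real) eigenvalue of a real square matrix. It is used for symmetric matrices of
positive size, whose set of real eigenvalues is finite and non-empty. -/
noncomputable def lambdaMin {ι : Type*} [Fintype ι] [DecidableEq ι] (M : Matrix ι ι ℝ) : ℝ :=
  sInf {μ : ℝ | Module.End.HasEigenvalue (Matrix.toLin' M) μ}

/-- The multiplicity of `μ` as an eigenvalue of `M`, that is, the dimension of the eigenspace
(for symmetric matrices this agrees with the algebraic multiplicity). -/
noncomputable def multiplicity {ι : Type*} [Fintype ι] [DecidableEq ι] (M : Matrix ι ι ℝ)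
    (μ : ℝ) : ℕ :=
  Module.finrank ℝ (Module.End.eigenspace (Matrix.toLin' M) μ)

/-- The objective `xᵀ A x - 2 aᵀ x`. -/
def objective {n : ℕ} (A : Matrix (Fin n) (Fin n) ℝ) (a x : Fin n → ℝ) : ℝ :=
  x ⬝ᵥ (A *ᵥ x) - 2 * (a ⬝ᵥ x)

/-- The feasible set `‖x‖² ≤ Δ`, `bᵀ x ≤ c`, where `‖x‖² = xᵀ x` is the squared Euclidean norm. -/
def feasible {n : ℕ} (b : Fin n → ℝ) (c Δ : ℝ) : Set (Fin n → ℝ) :=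
  {x | x ⬝ᵥ x ≤ Δ ∧ b ⬝ᵥ x ≤ c}

/-- The optimal value `p*` of the extended trust region subproblem. -/
noncomputable def primalValue {n : ℕ} (A : Matrix (Fin n) (Fin n) ℝ) (a b : Fin n → ℝ)
    (c Δ : ℝ) : EReal :=
  ⨅ x ∈ feasible b c Δ, (objective A a x : EReal)

/-- The Lagrangian, with multipliers `l₁` for the norm constraint and `l₂` for the linear one. -/
def lagrangian {n : ℕ} (A : Matrix (Fin n) (Fin n) ℝ) (a b : Fin n → ℝ) (c Δ : ℝ)
    (l₁ l₂ : ℝ) (x : Fin n → ℝ) : ℝ :=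
  objective A a x + l₁ * (x ⬝ᵥ x - Δ) + l₂ * (b ⬝ᵥ x - c)

/-- The optimal value `d*` of the Lagrangian dual problem
`max_{l₁, l₂ ≥ 0} min_x L(x, l₁, l₂)`. -/
noncomputable def dualValue {n : ℕ} (A : Matrix (Fin n) (Fin n) ℝ) (a b : Fin n → ℝ)
    (c Δ : ℝ) : EReal :=
  ⨆ (l₁ : ℝ) (_ : 0 ≤ l₁) (l₂ : ℝ) (_ : 0 ≤ l₂),
    ⨅ x : Fin n → ℝ, (lagrangian A a b c Δ l₁ l₂ x : EReal)

/-- Strong duality: `p* = d*`. -/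
def StrongDuality {n : ℕ} (A : Matrix (Fin n) (Fin n) ℝ) (a b : Fin n → ℝ) (c Δ : ℝ) : Prop :=
  primalValue A a b c Δ = dualValue A a b c Δ

/-- The bordered matrix `D(t, l) = [t, (-a + (l/2) b)ᵀ; -a + (l/2) b, A]`. -/
noncomputable def D {n : ℕ} (A : Matrix (Fin n) (Fin n) ℝ) (a b : Fin n → ℝ) (t l : ℝ) :
    Matrix (Unit ⊕ Fin n) (Unit ⊕ Fin n) ℝ :=
  Matrix.fromBlocks (Matrix.of fun _ _ => t) (Matrix.replicateRow Unit (-a + (l / 2) • b))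
    (Matrix.replicateCol Unit (-a + (l / 2) • b)) A

/-- The objective `k(t, l) = (Δ + 1) λ_min(D(t, l)) - t - l c` of the eigenvalue dual problem. -/
noncomputable def k {n : ℕ} (A : Matrix (Fin n) (Fin n) ℝ) (a b : Fin n → ℝ) (c Δ : ℝ)
    (t l : ℝ) : ℝ :=
  (Δ + 1) * lambdaMin (D A a b t l) - t - l * c

/-- The feasible set `l ≥ 0`, `λ_min(D(t, l)) ≤ 0` of the eigenvalue dual problem. -/
def eigFeasible {n : ℕ} (A : Matrix (Fin n) (Fin n) ℝ) (a b : Fin n → ℝ) : Set (ℝ × ℝ) :=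
  {p | 0 ≤ p.2 ∧ lambdaMin (D A a b p.1 p.2) ≤ 0}

/-- `(t, l)` is an optimal solution of the eigenvalue dual problem
`max k(t, l)` subject to `l ≥ 0`, `λ_min(D(t, l)) ≤ 0`. -/
def IsEigOptimal {n : ℕ} (A : Matrix (Fin n) (Fin n) ℝ) (a b : Fin n → ℝ) (c Δ : ℝ)
    (t l : ℝ) : Prop :=
  (t, l) ∈ eigFeasible A a b ∧
    IsMaxOn (fun p : ℝ × ℝ => k A a b c Δ p.1 p.2) (eigFeasible A a b) (t, l)

end ETRS

namespace ETRS

/-! Write μ for `lambdaMin A`, so μ ≤ 0. Adding μ(Δ - xᵀx) to the objective makes it convex and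
lowers it on the ball, without changing it on the sphere. Let y minimize this `convexified` function
over the feasible set. Under Slater's condition convex duality supplies multipliers
(`exists_multipliers`), and homogenizing the Lagrangian into D(t, l) bounds the minimum by the
optimal k (`convexified_le_k`). Hence the multipliers -λ_min(D(t, l)) and l keep the Lagrangian
above that minimum everywhere, while no dual bound exceeds it (`exists_lagrangian_le_convexified`).
So strong duality holds exactly when some feasible point has objective at most this minimum.

If none does, y lies strictly inside the ball and complementary slackness gives λ_min(D) = μ. Along
a μ-eigenvector u the convexified function is affine with slope -l bᵀu. Were l bᵀu = 0, moving along
u or -u would reach a feasible point of the sphere with objective equal to the minimum. So l > 0,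
bᵀu ≠ 0 for every such u, the eigenspace is a line, and the line through y meets the sphere on both
sides of bᵀx = c (`exists_two_solutions`).

Conversely, under the two conditions strong duality would give a stationary point on the sphere with
bᵀx = c. The only stationary points on the sphere are x₁ and x₂, which are off that hyperplane. -/

theorem isSymm_sub_smul_one {ι : Type*} [DecidableEq ι] {M : Matrix ι ι ℝ} (hM : M.IsSymm)
    (μ : ℝ) : (M - μ • (1 : Matrix ι ι ℝ)).IsSymm :=
  hM.sub (Matrix.isSymm_one.smul μ)

/-! ### Quadratic forms and the smallest eigenvalue -/

section Quadratic

variable {ι : Type*} [Fintype ι] {M : Matrix ι ι ℝ}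

theorem dotProduct_mulVec_symm (hM : M.IsSymm) (x y : ι → ℝ) : x ⬝ᵥ M *ᵥ y = y ⬝ᵥ M *ᵥ x := by
  rw [Matrix.dotProduct_mulVec, ← Matrix.mulVec_transpose, hM.eq, dotProduct_comm]

theorem quadratic_add_smul (hM : M.IsSymm) (x y : ι → ℝ) (s : ℝ) :
    (x + s • y) ⬝ᵥ M *ᵥ (x + s • y) =
      x ⬝ᵥ M *ᵥ x + 2 * s * (y ⬝ᵥ M *ᵥ x) + s ^ 2 * (y ⬝ᵥ M *ᵥ y) := by
  simp only [Matrix.mulVec_add, Matrix.mulVec_smul, add_dotProduct, dotProduct_add,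
    smul_dotProduct, dotProduct_smul, smul_eq_mul]
  rw [dotProduct_mulVec_symm hM x y]
  ring

theorem norm_add_smul (x y : ι → ℝ) (s : ℝ) :
    (x + s • y) ⬝ᵥ (x + s • y) = x ⬝ᵥ x + 2 * s * (x ⬝ᵥ y) + s ^ 2 * (y ⬝ᵥ y) := by
  simp only [add_dotProduct, dotProduct_add, smul_dotProduct, dotProduct_smul, smul_eq_mul]
  rw [dotProduct_comm y x]
  ring

theorem dotProduct_self_nonneg (x : ι → ℝ) : 0 ≤ x ⬝ᵥ x :=
  Finset.sum_nonneg fun _ _ => mul_self_nonneg _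

theorem continuous_dotProduct (v : ι → ℝ) : Continuous fun x : ι → ℝ => v ⬝ᵥ x := by
  unfold dotProduct
  fun_prop

theorem continuous_dotProduct_self : Continuous fun x : ι → ℝ => x ⬝ᵥ x := by
  unfold dotProduct
  fun_prop

theorem norm_pos_of_ne_zero {x : ι → ℝ} (hx : x ≠ 0) : 0 < x ⬝ᵥ x :=
  lt_of_le_of_ne (dotProduct_self_nonneg x) fun h => hx (dotProduct_self_eq_zero.mp h.symm)

/-- First order condition for a global minimizer of a quadratic function. -/
theorem mulVec_eq_of_isMin (hM : M.IsSymm) (v y : ι → ℝ)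
    (h : ∀ x, y ⬝ᵥ M *ᵥ y - 2 * (v ⬝ᵥ y) ≤ x ⬝ᵥ M *ᵥ x - 2 * (v ⬝ᵥ x)) : M *ᵥ y = v := by
  set g : ι → ℝ := M *ᵥ y - v with hg
  -- Perturbing y along the gradient g gives a nonnegative quadratic in s with zero constant term,
  -- so its linear coefficient 2 gᵀg vanishes.
  have key : ∀ s : ℝ, 0 ≤ (g ⬝ᵥ M *ᵥ g) * (s * s) + 2 * (g ⬝ᵥ g) * s + 0 := by
    intro s
    have h1 := h (y + s • g)
    rw [quadratic_add_smul hM, dotProduct_add, dotProduct_smul, smul_eq_mul] at h1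
    have h2 : g ⬝ᵥ g = g ⬝ᵥ M *ᵥ y - v ⬝ᵥ g := by
      conv_lhs => rw [hg, dotProduct_sub]
      rw [dotProduct_comm v]
    rw [h2]
    nlinarith
  have h3 := discrim_le_zero key
  have h4 : g ⬝ᵥ g = 0 := by
    rw [discrim] at h3
    nlinarith [sq_nonneg (g ⬝ᵥ g)]
  exact sub_eq_zero.mp (dotProduct_self_eq_zero.mp h4)

theorem isCompact_norm_le (Δ : ℝ) : IsCompact {x : ι → ℝ | x ⬝ᵥ x ≤ Δ} := by
  refine Metric.isCompact_of_isClosed_isBounded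
    (isClosed_le continuous_dotProduct_self continuous_const) ?_
  refine (Metric.isBounded_closedBall (x := (0 : ι → ℝ)) (r := Real.sqrt Δ)).subset fun x hx => ?_
  rw [mem_closedBall_zero_iff, pi_norm_le_iff_of_nonneg (Real.sqrt_nonneg _)]
  intro i
  rw [Real.norm_eq_abs]
  refine Real.abs_le_sqrt (le_trans ?_ hx)
  rw [sq]
  exact Finset.single_le_sum (f := fun i => x i * x i) (fun i _ => mul_self_nonneg _)
    (Finset.mem_univ i)

theorem continuous_quadratic (M : Matrix ι ι ℝ) : Continuous fun x : ι → ℝ => x ⬝ᵥ M *ᵥ x := by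
  unfold Matrix.mulVec dotProduct
  fun_prop

variable [DecidableEq ι]

theorem mem_eigenspace_toLin' (M : Matrix ι ι ℝ) (μ : ℝ) (x : ι → ℝ) :
    x ∈ Module.End.eigenspace (Matrix.toLin' M) μ ↔ M *ᵥ x = μ • x := by
  rw [Module.End.mem_eigenspace_iff, Matrix.toLin'_apply]

theorem sub_smul_one_mulVec (M : Matrix ι ι ℝ) (μ : ℝ) (x : ι → ℝ) :
    (M - μ • (1 : Matrix ι ι ℝ)) *ᵥ x = M *ᵥ x - μ • x := by
  rw [Matrix.sub_mulVec, Matrix.smul_mulVec, Matrix.one_mulVec]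

theorem exists_unit_minimizer [Nonempty ι] (M : Matrix ι ι ℝ) :
    ∃ u : ι → ℝ, u ⬝ᵥ u = 1 ∧ ∀ x, (u ⬝ᵥ M *ᵥ u) * (x ⬝ᵥ x) ≤ x ⬝ᵥ M *ᵥ x := by
  have hc : IsCompact {x : ι → ℝ | x ⬝ᵥ x = 1} :=
    (isCompact_norm_le 1).of_isClosed_subset
      (isClosed_eq continuous_dotProduct_self continuous_const) fun x hx => le_of_eq hx
  have hne : {x : ι → ℝ | x ⬝ᵥ x = 1}.Nonempty := by
    obtain ⟨i⟩ := ‹Nonempty ι›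
    exact ⟨Pi.single i 1, by simp⟩
  obtain ⟨u, hu, hmin⟩ := hc.exists_isMinOn hne (continuous_quadratic M).continuousOn
  refine ⟨u, hu, fun x => ?_⟩
  rcases eq_or_ne x 0 with rfl | hx
  · simp
  have hp := norm_pos_of_ne_zero hx
  set r := Real.sqrt (x ⬝ᵥ x) with hr
  have hr2 : r ^ 2 = x ⬝ᵥ x := Real.sq_sqrt hp.le
  have hr0 : r ≠ 0 := (Real.sqrt_pos.mpr hp).ne'
  have h1 : r⁻¹ • x ∈ {x : ι → ℝ | x ⬝ᵥ x = 1} := by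
    simp only [Set.mem_ofPred_eq, smul_dotProduct, dotProduct_smul, smul_eq_mul, ← hr2]
    field_simp
  have h2 : u ⬝ᵥ M *ᵥ u ≤ (r⁻¹ • x) ⬝ᵥ M *ᵥ (r⁻¹ • x) := hmin h1
  simp only [Matrix.mulVec_smul, smul_dotProduct, dotProduct_smul, smul_eq_mul] at h2
  calc (u ⬝ᵥ M *ᵥ u) * (x ⬝ᵥ x) ≤ (r⁻¹ * (r⁻¹ * (x ⬝ᵥ M *ᵥ x))) * (x ⬝ᵥ x) :=
        mul_le_mul_of_nonneg_right h2 hp.le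
    _ = x ⬝ᵥ M *ᵥ x := by
        rw [← hr2]
        field_simp

/-- `lambdaMin` is attained at a unit eigenvector and bounds the Rayleigh quotient from below. -/
theorem lambdaMin_spec [Nonempty ι] (hM : M.IsSymm) :
    (∃ u : ι → ℝ, u ⬝ᵥ u = 1 ∧ M *ᵥ u = lambdaMin M • u) ∧
      ∀ x, lambdaMin M * (x ⬝ᵥ x) ≤ x ⬝ᵥ M *ᵥ x := by
  obtain ⟨u, hu, hmin⟩ := exists_unit_minimizer M
  set q := u ⬝ᵥ M *ᵥ u with hq
  have hquad : ∀ x, x ⬝ᵥ (M - q • (1 : Matrix ι ι ℝ)) *ᵥ x = x ⬝ᵥ M *ᵥ x - q * (x ⬝ᵥ x) :=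
    fun x => by rw [sub_smul_one_mulVec, dotProduct_sub, dotProduct_smul, smul_eq_mul]
  have hker : M *ᵥ u = q • u := by
    have := mulVec_eq_of_isMin (isSymm_sub_smul_one hM q) 0 u fun x => by
      rw [hquad, hquad, hu, ← hq, zero_dotProduct, zero_dotProduct]
      linarith [hmin x]
    rwa [sub_smul_one_mulVec, sub_eq_zero] at this
  have hleast : IsLeast {μ : ℝ | Module.End.HasEigenvalue (Matrix.toLin' M) μ} q := by
    constructor
    · refine Module.End.hasEigenvalue_of_hasEigenvector (x := u)
        ⟨(mem_eigenspace_toLin' M q u).mpr hker, ?_⟩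
      rintro rfl
      simp at hu
    · intro μ hμ
      obtain ⟨w, hw, hw0⟩ := Module.End.HasEigenvalue.exists_hasEigenvector hμ
      have h1 := hmin w
      rw [(mem_eigenspace_toLin' M μ w).mp hw, dotProduct_smul, smul_eq_mul] at h1
      exact le_of_mul_le_mul_right h1 (norm_pos_of_ne_zero hw0)
  have hl : lambdaMin M = q := hleast.csInf_eq
  rw [hl]
  exact ⟨⟨u, hu, hker⟩, hmin⟩

theorem le_lambdaMin [Nonempty ι] (hM : M.IsSymm) {s : ℝ}
    (h : ∀ x, s * (x ⬝ᵥ x) ≤ x ⬝ᵥ M *ᵥ x) : s ≤ lambdaMin M := by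
  obtain ⟨⟨u, hu, he⟩, -⟩ := lambdaMin_spec hM
  have := h u
  rwa [he, dotProduct_smul, hu, smul_eq_mul, mul_one, mul_one] at this

end Quadratic

/-- A point strictly inside a ball reaches the sphere along any direction. -/
theorem exists_pos_norm_eq {ι : Type*} [Fintype ι] {x u : ι → ℝ} {Δ : ℝ} (hx : x ⬝ᵥ x < Δ)
    (hu : u ≠ 0) : ∃ s : ℝ, 0 < s ∧ (x + s • u) ⬝ᵥ (x + s • u) = Δ := by
  have hp := norm_pos_of_ne_zero hu
  set p := u ⬝ᵥ u
  set β := x ⬝ᵥ u with hβ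
  have hd : 0 < p * (Δ - x ⬝ᵥ x) := mul_pos hp (by linarith)
  set r := Real.sqrt (β ^ 2 + p * (Δ - x ⬝ᵥ x)) with hr
  have hr2 : r ^ 2 = β ^ 2 + p * (Δ - x ⬝ᵥ x) := Real.sq_sqrt (by positivity)
  have hlt : β < r := Real.lt_sqrt_of_sq_lt (by linarith)
  refine ⟨(r - β) / p, div_pos (by linarith) hp, ?_⟩
  rw [norm_add_smul]
  field_simp
  rw [← hβ]
  linear_combination p * hr2

/-! ### Convex duality under Slater's condition -/

/-- Lagrange multipliers for a convex function under two convex constraints satisfying the Slater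
condition. -/
theorem exists_multipliers {E : Type*} [AddCommGroup E] [Module ℝ E] {f g₁ g₂ : E → ℝ} {m : ℝ}
    (hf : ConvexOn ℝ Set.univ f) (hg₁ : ConvexOn ℝ Set.univ g₁) (hg₂ : ConvexOn ℝ Set.univ g₂)
    (hm : ∀ x, g₁ x ≤ 0 → g₂ x ≤ 0 → m ≤ f x) (hs : ∃ x, g₁ x < 0 ∧ g₂ x < 0) :
    ∃ μ₁ μ₂ : ℝ, 0 ≤ μ₁ ∧ 0 ≤ μ₂ ∧ ∀ x, m ≤ f x + μ₁ * g₁ x + μ₂ * g₂ x := by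
  set C : Set (ℝ × ℝ × ℝ) := {p | ∃ x, g₁ x < p.1 ∧ g₂ x < p.2.1 ∧ f x - m < p.2.2} with hC
  have hopen : IsOpen C := by
    have : C = ⋃ x, {p : ℝ × ℝ × ℝ | g₁ x < p.1 ∧ g₂ x < p.2.1 ∧ f x - m < p.2.2} := by
      ext p
      simp [hC]
    rw [this]
    refine isOpen_iUnion fun x => ?_
    exact (isOpen_lt continuous_const continuous_fst).inter
      ((isOpen_lt continuous_const (continuous_fst.comp continuous_snd)).inter
        (isOpen_lt continuous_const (continuous_snd.comp continuous_snd)))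
  have hconv : Convex ℝ C := by
    rintro p ⟨x, hx1, hx2, hx3⟩ q ⟨y, hy1, hy2, hy3⟩ α β hα hβ hαβ
    refine ⟨α • x + β • y, ?_, ?_, ?_⟩
    · have := hg₁.2 (Set.mem_univ x) (Set.mem_univ y) hα hβ hαβ
      simp only [smul_eq_mul, Prod.fst_add, Prod.smul_fst] at this ⊢
      rcases hα.eq_or_lt with h | h
      · subst h
        obtain rfl : β = 1 := by linarith
        linarith
      · nlinarith
    · have := hg₂.2 (Set.mem_univ x) (Set.mem_univ y) hα hβ hαβ
      simp only [smul_eq_mul, Prod.fst_add, Prod.smul_fst, Prod.snd_add, Prod.smul_snd] at this ⊢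
      rcases hα.eq_or_lt with h | h
      · subst h
        obtain rfl : β = 1 := by linarith
        linarith
      · nlinarith
    · have := hf.2 (Set.mem_univ x) (Set.mem_univ y) hα hβ hαβ
      simp only [smul_eq_mul, Prod.snd_add, Prod.smul_snd] at this ⊢
      obtain rfl : β = 1 - α := by linarith
      rcases hα.eq_or_lt with h | h
      · subst h
        linarith
      · nlinarith
  have h0 : (0 : ℝ × ℝ × ℝ) ∉ C := by
    rintro ⟨x, hx1, hx2, hx3⟩
    simp only [Prod.fst_zero, Prod.snd_zero] at hx1 hx2 hx3
    linarith [hm x hx1.le hx2.le]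
  obtain ⟨φ, hφ⟩ := geometric_hahn_banach_open_point hconv hopen h0
  set α := φ (1, 0, 0)
  set β := φ (0, 1, 0)
  set γ := φ (0, 0, 1)
  have hrep : ∀ u v w : ℝ, φ (u, v, w) = u * α + v * β + w * γ := by
    intro u v w
    have : ((u, v, w) : ℝ × ℝ × ℝ) = u • (1, 0, 0) + v • (0, 1, 0) + w • (0, 0, 1) := by simp
    rw [this, map_add, map_add, map_smul, map_smul, map_smul]
    rfl
  have hneg : ∀ x u v w, g₁ x < u → g₂ x < v → f x - m < w → u * α + v * β + w * γ < 0 := by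
    intro x u v w h1 h2 h3
    have := hφ (u, v, w) ⟨x, h1, h2, h3⟩
    rwa [hrep, map_zero] at this
  obtain ⟨z, hz1, hz2⟩ := hs
  -- a functional that is negative on an upward closed set has nonpositive coefficients
  have hsign : ∀ κ d : ℝ, (∀ s : ℝ, 0 ≤ s → d + s * κ < 0) → κ ≤ 0 := by
    intro κ d h
    by_contra! hκ
    have := h (|d| / κ) (by positivity)
    rw [div_mul_cancel₀ _ hκ.ne'] at this
    linarith [neg_abs_le d]
  have hα : α ≤ 0 := hsign α (1 * α + 1 * β + (f z - m + 1) * γ) fun s hs => by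
    have := hneg z (1 + s) 1 (f z - m + 1) (by linarith) (by linarith) (by linarith)
    linarith
  have hβ : β ≤ 0 := hsign β (1 * α + 1 * β + (f z - m + 1) * γ) fun s hs => by
    have := hneg z 1 (1 + s) (f z - m + 1) (by linarith) (by linarith) (by linarith)
    linarith
  have hγ : γ < 0 := by
    have hγ' : γ ≤ 0 := hsign γ (1 * α + 1 * β + (f z - m + 1) * γ) fun s hs => by
      have := hneg z 1 1 (f z - m + 1 + s) (by linarith) (by linarith) (by linarith)
      linarith
    -- Slater's condition excludes γ = 0: halving the negative constraint values at z stays in `C`,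
    -- yet α, β ≤ 0 makes the functional nonnegative there.
    refine lt_of_le_of_ne hγ' fun h => ?_
    have := hneg z (g₁ z / 2) (g₂ z / 2) (f z - m + 1) (by linarith) (by linarith) (by linarith)
    rw [h] at this
    nlinarith
  have hle : ∀ x, g₁ x * α + g₂ x * β + (f x - m) * γ ≤ 0 := by
    intro x
    refine le_of_forall_pos_lt_add fun ε hε => ?_
    have hd : 0 < 1 - α - β - γ := by linarith
    -- Membership in `C` is strict, so all three coordinates are raised by δ, chosen so that the
    -- resulting error -δ(α + β + γ) = ε - δ is below ε.
    set δ := ε / (1 - α - β - γ) with hδ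
    have hδ0 : 0 < δ := div_pos hε hd
    have h1 := hneg x (g₁ x + δ) (g₂ x + δ) (f x - m + δ) (by linarith) (by linarith)
      (by linarith)
    have h2 : δ * (1 - α - β - γ) = ε := div_mul_cancel₀ _ hd.ne'
    linarith
  refine ⟨α / γ, β / γ, div_nonneg_of_nonpos hα hγ.le, div_nonneg_of_nonpos hβ hγ.le,
    fun x => ?_⟩
  have h1 : 0 ≤ (g₁ x * α + g₂ x * β + (f x - m) * γ) / γ :=
    div_nonneg_of_nonpos (hle x) hγ.le
  have h2 : (g₁ x * α + g₂ x * β + (f x - m) * γ) / γ =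
      f x + α / γ * g₁ x + β / γ * g₂ x - m := by
    field_simp [hγ.ne]
    ring
  linarith

theorem convexOn_quadratic {ι : Type*} [Fintype ι] {M : Matrix ι ι ℝ} (hM : M.IsSymm)
    (hpos : ∀ x, 0 ≤ x ⬝ᵥ M *ᵥ x) (v : ι → ℝ) (d : ℝ) :
    ConvexOn ℝ Set.univ fun x : ι → ℝ => x ⬝ᵥ M *ᵥ x + v ⬝ᵥ x + d := by
  refine ⟨convex_univ, fun x _ y _ α β hα hβ hαβ => ?_⟩
  obtain rfl : β = 1 - α := by linarith
  have h1 := hpos (y - x)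
  have h2 : α • x + (1 - α) • y = x + (1 - α) • (y - x) := by module
  have h3 : y = x + (1 : ℝ) • (y - x) := by module
  have h4 := quadratic_add_smul hM x (y - x) 1
  rw [← h3] at h4
  have h5 := congrArg (v ⬝ᵥ ·) h3
  simp only [dotProduct_add, dotProduct_smul, smul_eq_mul] at h5
  simp only [smul_eq_mul]
  rw [h2, quadratic_add_smul hM, dotProduct_add, dotProduct_smul, smul_eq_mul, h4, h5]
  nlinarith [mul_nonneg (mul_nonneg hα hβ) h1]

theorem convexOn_dotProduct_sub {ι : Type*} [Fintype ι] (b : ι → ℝ) (c : ℝ) :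
    ConvexOn ℝ Set.univ fun x : ι → ℝ => b ⬝ᵥ x - c := by
  have := convexOn_quadratic (Matrix.isSymm_zero (n := ι) (α := ℝ)) (by simp) b (-c)
  simpa [sub_eq_add_neg] using this

theorem convexOn_dotProduct_self_sub {ι : Type*} [Fintype ι] (Δ : ℝ) :
    ConvexOn ℝ Set.univ fun x : ι → ℝ => x ⬝ᵥ x - Δ := by
  classical
  have := convexOn_quadratic (Matrix.isSymm_one (n := ι) (α := ℝ))
    (fun x => by simpa using dotProduct_self_nonneg x) 0 (-Δ)
  simpa [sub_eq_add_neg] using this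

/-! ### The bordered matrix, the Lagrangian and weak duality -/

section ETRS

variable {n : ℕ} {A : Matrix (Fin n) (Fin n) ℝ} {a b : Fin n → ℝ} {c Δ : ℝ}

theorem D_isSymm (hA : A.IsSymm) (t l : ℝ) : (D A a b t l).IsSymm := by
  refine Matrix.IsSymm.fromBlocks ?_ ?_ hA
  · ext i j
    rfl
  · exact Matrix.transpose_replicateRow _

theorem quadratic_D (t l z : ℝ) (x : Fin n → ℝ) :
    Sum.elim (fun _ : Unit => z) x ⬝ᵥ D A a b t l *ᵥ Sum.elim (fun _ : Unit => z) x =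
      z ^ 2 * t + 2 * z * ((-a + (l / 2) • b) ⬝ᵥ x) + x ⬝ᵥ A *ᵥ x := by
  set w := -a + (l / 2) • b with hw
  have h2 : (Matrix.of fun _ _ : Unit => t) *ᵥ (fun _ => z) = fun _ => t * z := by
    ext i
    simp [Matrix.mulVec, dotProduct]
  have h3 : Matrix.replicateRow Unit w *ᵥ x = fun _ => w ⬝ᵥ x := by
    ext i
    simp [Matrix.mulVec, dotProduct]
  have h4 : Matrix.replicateCol Unit w *ᵥ (fun _ => z) = z • w := by
    ext i
    simp [Matrix.mulVec, dotProduct, mul_comm]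
  rw [D, Matrix.fromBlocks_mulVec, Sum.elim_comp_inl, Sum.elim_comp_inr, ← hw, h2, h3, h4,
    sumElim_dotProduct_sumElim, dotProduct_add, dotProduct_add, dotProduct_smul,
    dotProduct_comm x w]
  simp only [dotProduct, Finset.univ_unique, Finset.sum_singleton, smul_eq_mul]
  ring

theorem norm_sumElim (z : ℝ) (x : Fin n → ℝ) :
    Sum.elim (fun _ : Unit => z) x ⬝ᵥ Sum.elim (fun _ : Unit => z) x = z ^ 2 + x ⬝ᵥ x := by
  rw [sumElim_dotProduct_sumElim]
  simp [dotProduct, sq]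

theorem lambdaMin_D_le [NeZero n] (hA : A.IsSymm) (t l : ℝ) :
    lambdaMin (D A a b t l) ≤ lambdaMin A := by
  refine le_lambdaMin hA fun x => ?_
  have := (lambdaMin_spec (D_isSymm (a := a) (b := b) hA t l)).2 (Sum.elim (fun _ => 0) x)
  rw [quadratic_D, norm_sumElim] at this
  linarith

theorem lagrangian_eq (l₁ l₂ : ℝ) (x : Fin n → ℝ) :
    lagrangian A a b c Δ l₁ l₂ x =
      x ⬝ᵥ A *ᵥ x + 2 * ((-a + (l₂ / 2) • b) ⬝ᵥ x) + l₁ * (x ⬝ᵥ x) - l₁ * Δ - l₂ * c := by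
  rw [lagrangian, objective, add_dotProduct, neg_dotProduct, smul_dotProduct, smul_eq_mul]
  ring

/-- The Rayleigh bound for D(t, l) tested on the vector (1, x). -/
theorem k_le_lagrangian (hA : A.IsSymm) (t l : ℝ) (x : Fin n → ℝ) :
    k A a b c Δ t l ≤ lagrangian A a b c Δ (-lambdaMin (D A a b t l)) l x := by
  have := (lambdaMin_spec (D_isSymm (a := a) (b := b) hA t l)).2 (Sum.elim (fun _ => 1) x)
  rw [quadratic_D, norm_sumElim] at this
  rw [lagrangian_eq, k]
  linarith

/-- Homogenization: on (z, x) with z ≠ 0 the form of D is z² times its value at (1, x/z), where the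
Lagrangian bound applies; z = 0 needs `hpos` separately. -/
theorem exists_le_k (hA : A.IsSymm) {l₁ l₂ m : ℝ}
    (hpos : ∀ x, 0 ≤ x ⬝ᵥ A *ᵥ x + l₁ * (x ⬝ᵥ x))
    (hm : ∀ x, m ≤ lagrangian A a b c Δ l₁ l₂ x) (hΔ : 0 < Δ) : ∃ t, m ≤ k A a b c Δ t l₂ := by
  -- This t makes k equal to m when λ_min(D) = -l₁; the proof shows λ_min(D) ≥ -l₁.
  refine ⟨-m - l₁ * Δ - l₂ * c - l₁, ?_⟩
  set t := -m - l₁ * Δ - l₂ * c - l₁ with ht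
  have hle : -l₁ ≤ lambdaMin (D A a b t l₂) := by
    refine le_lambdaMin (D_isSymm hA _ _) fun y => ?_
    obtain ⟨z, x, rfl⟩ : ∃ (z : ℝ) (x : Fin n → ℝ), y = Sum.elim (fun _ : Unit => z) x :=
      ⟨y (Sum.inl ()), y ∘ Sum.inr, by ext (i | i) <;> rfl⟩
    rw [quadratic_D, norm_sumElim]
    rcases eq_or_ne z 0 with rfl | hz
    · linarith [hpos x]
    · have h1 := hm (z⁻¹ • x)
      rw [lagrangian_eq] at h1
      simp only [Matrix.mulVec_smul, smul_dotProduct, dotProduct_smul, smul_eq_mul] at h1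
      have h2 := mul_le_mul_of_nonneg_left h1 (sq_nonneg z)
      have h3 : z ^ 2 * (z⁻¹ * (z⁻¹ * (x ⬝ᵥ A *ᵥ x)) +
          2 * (z⁻¹ * ((-a + (l₂ / 2) • b) ⬝ᵥ x)) + l₁ * (z⁻¹ * (z⁻¹ * (x ⬝ᵥ x))) - l₁ * Δ -
          l₂ * c) = x ⬝ᵥ A *ᵥ x + 2 * z * ((-a + (l₂ / 2) • b) ⬝ᵥ x) + l₁ * (x ⬝ᵥ x) -
          z ^ 2 * (l₁ * Δ + l₂ * c) := by
        field_simp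
        ring
      rw [h3] at h2
      rw [ht]
      linarith
  rw [k]
  have := mul_le_mul_of_nonneg_left hle (show (0 : ℝ) ≤ Δ + 1 by linarith)
  linarith

theorem lambdaMin_nonpos [NeZero n] (hA : A.IsSymm) (hpd : ¬ A.PosDef) : lambdaMin A ≤ 0 := by
  by_contra! h
  refine hpd (Matrix.PosDef.of_dotProduct_mulVec_pos ?_ fun x hx => ?_)
  · rw [Matrix.IsHermitian, Matrix.conjTranspose_eq_transpose_of_trivial]
    exact hA
  · rw [star_trivial]
    exact lt_of_lt_of_le (mul_pos h (norm_pos_of_ne_zero hx)) ((lambdaMin_spec hA).2 x)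

theorem isCompact_feasible (b : Fin n → ℝ) (c Δ : ℝ) : IsCompact (feasible b c Δ) :=
  (isCompact_norm_le Δ).inter_right
    (isClosed_le (continuous_dotProduct b) continuous_const)

theorem continuous_objective (A : Matrix (Fin n) (Fin n) ℝ) (a : Fin n → ℝ) :
    Continuous (objective A a) := by
  exact (continuous_quadratic A).sub (continuous_const.mul (continuous_dotProduct a))

theorem lagrangian_le_objective {l₁ l₂ : ℝ} (h₁ : 0 ≤ l₁) (h₂ : 0 ≤ l₂) {x : Fin n → ℝ}
    (hx : x ∈ feasible b c Δ) : lagrangian A a b c Δ l₁ l₂ x ≤ objective A a x := by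
  rw [lagrangian]
  nlinarith [hx.1, hx.2]

theorem strongDuality_of_le {l₁ l₂ m : ℝ} (h₁ : 0 ≤ l₁) (h₂ : 0 ≤ l₂)
    (hm : ∀ x, m ≤ lagrangian A a b c Δ l₁ l₂ x) {y : Fin n → ℝ} (hy : y ∈ feasible b c Δ)
    (hym : objective A a y ≤ m) : StrongDuality A a b c Δ := by
  refine le_antisymm ?_ ?_
  · calc primalValue A a b c Δ ≤ (objective A a y : EReal) := iInf₂_le y hy
      _ ≤ (m : EReal) := EReal.coe_le_coe_iff.mpr hym
      _ ≤ ⨅ x, (lagrangian A a b c Δ l₁ l₂ x : EReal) :=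
          le_iInf fun x => EReal.coe_le_coe_iff.mpr (hm x)
      _ ≤ dualValue A a b c Δ :=
          le_iSup₂_of_le l₁ h₁ (le_iSup₂_of_le l₂ h₂ le_rfl)
  · refine iSup₂_le fun l₁ h₁ => iSup₂_le fun l₂ h₂ => le_iInf₂ fun x hx => ?_
    exact (iInf_le _ x).trans (EReal.coe_le_coe_iff.mpr (lagrangian_le_objective h₁ h₂ hx))

theorem exists_objective_le_of_strongDuality (hne : (feasible b c Δ).Nonempty)
    (h : StrongDuality A a b c Δ) {m : ℝ}
    (hm : ∀ l₁ l₂ : ℝ, 0 ≤ l₁ → 0 ≤ l₂ → ∃ x, lagrangian A a b c Δ l₁ l₂ x ≤ m) :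
    ∃ y ∈ feasible b c Δ, objective A a y ≤ m := by
  obtain ⟨y, hy, hmin⟩ :=
    (isCompact_feasible b c Δ).exists_isMinOn hne (continuous_objective A a).continuousOn
  refine ⟨y, hy, EReal.coe_le_coe_iff.mp ?_⟩
  calc (objective A a y : EReal) ≤ primalValue A a b c Δ :=
        le_iInf₂ fun x hx => EReal.coe_le_coe_iff.mpr (hmin hx)
    _ = dualValue A a b c Δ := h
    _ ≤ m := iSup₂_le fun l₁ h₁ => iSup₂_le fun l₂ h₂ => by
        obtain ⟨x, hx⟩ := hm l₁ l₂ h₁ h₂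
        exact (iInf_le _ x).trans (EReal.coe_le_coe_iff.mpr hx)

/-! ### The convexified problem and its dual value -/

/-- The objective shifted to the convex function `xᵀ(A - λ_min I)x - 2aᵀx + λ_min Δ`; the two agree
on the sphere `xᵀx = Δ`. -/
noncomputable def convexified (A : Matrix (Fin n) (Fin n) ℝ) (a : Fin n → ℝ) (Δ : ℝ)
    (x : Fin n → ℝ) : ℝ :=
  objective A a x + lambdaMin A * (Δ - x ⬝ᵥ x)

theorem lagrangian_eq_convexified (l₁ l₂ : ℝ) (x : Fin n → ℝ) :
    lagrangian A a b c Δ l₁ l₂ x =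
      convexified A a Δ x + (l₁ + lambdaMin A) * (x ⬝ᵥ x - Δ) + l₂ * (b ⬝ᵥ x - c) := by
  rw [lagrangian, convexified]
  ring

theorem convexOn_convexified [NeZero n] (hA : A.IsSymm) (a : Fin n → ℝ) (Δ : ℝ) :
    ConvexOn ℝ Set.univ (convexified A a Δ) := by
  have h := convexOn_quadratic (isSymm_sub_smul_one hA (lambdaMin A)) (fun x => by
    rw [sub_smul_one_mulVec, dotProduct_sub, dotProduct_smul, smul_eq_mul, sub_nonneg]
    exact (lambdaMin_spec hA).2 x) ((-2 : ℝ) • a) (lambdaMin A * Δ)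
  convert h using 2 with x
  rw [convexified, objective, sub_smul_one_mulVec, dotProduct_sub, dotProduct_smul,
    smul_dotProduct, smul_eq_mul, smul_eq_mul]
  ring

theorem continuous_convexified (A : Matrix (Fin n) (Fin n) ℝ) (a : Fin n → ℝ) (Δ : ℝ) :
    Continuous (convexified A a Δ) := by
  exact (continuous_objective A a).add
    (continuous_const.mul (continuous_const.sub continuous_dotProduct_self))

/-- With u a unit eigenvector for λ_min and s² = Δ - xᵀx, the points x ± su have mean squared norm
Δ. The l₁ terms therefore cancel in the average of the two Lagrangian values, which is `convexified`
at x plus l₂(bᵀx - c); one of the two is no larger. -/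
theorem exists_lagrangian_le_convexified [NeZero n] (hA : A.IsSymm) {x : Fin n → ℝ}
    (hx : x ∈ feasible b c Δ) (l₁ : ℝ) {l₂ : ℝ} (h₂ : 0 ≤ l₂) :
    ∃ y, lagrangian A a b c Δ l₁ l₂ y ≤ convexified A a Δ x := by
  obtain ⟨⟨u, hu, he⟩, -⟩ := lambdaMin_spec hA
  have hs : (Real.sqrt (Δ - x ⬝ᵥ x)) ^ 2 = Δ - x ⬝ᵥ x :=
    Real.sq_sqrt (sub_nonneg.mpr hx.1)
  set s := Real.sqrt (Δ - x ⬝ᵥ x)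
  by_contra! h
  have hval : ∀ r : ℝ, r ^ 2 = s ^ 2 → lagrangian A a b c Δ l₁ l₂ (x + r • u) =
      convexified A a Δ x + l₂ * (b ⬝ᵥ x - c) +
        r * (2 * (u ⬝ᵥ A *ᵥ x) + 2 * ((-a + (l₂ / 2) • b) ⬝ᵥ u) + 2 * l₁ * (x ⬝ᵥ u)) := by
    intro r hr
    rw [lagrangian_eq, quadratic_add_smul hA, norm_add_smul, he, hr, hs, convexified, objective]
    simp only [dotProduct_add, dotProduct_smul, smul_eq_mul, add_dotProduct, neg_dotProduct,
      smul_dotProduct, hu]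
    ring
  have h1 := h (x + s • u)
  have h2 := h (x + (-s) • u)
  rw [hval s rfl] at h1
  rw [hval (-s) (by ring)] at h2
  have h3 := mul_nonneg h₂ (sub_nonneg.mpr hx.2)
  linarith

theorem exists_isMin_convexified (A : Matrix (Fin n) (Fin n) ℝ) (a : Fin n → ℝ)
    (hSlater : ∃ x : Fin n → ℝ, x ⬝ᵥ x < Δ ∧ b ⬝ᵥ x < c) :
    ∃ y ∈ feasible b c Δ, ∀ x ∈ feasible b c Δ, convexified A a Δ y ≤ convexified A a Δ x := by
  obtain ⟨z, hz1, hz2⟩ := hSlater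
  obtain ⟨y, hy, hmin⟩ := (isCompact_feasible b c Δ).exists_isMinOn ⟨z, hz1.le, hz2.le⟩
    (continuous_convexified A a Δ).continuousOn
  exact ⟨y, hy, fun x hx => hmin hx⟩

theorem convexified_le_k [NeZero n] (hA : A.IsSymm) (hpd : ¬ A.PosDef) (hΔ : 0 < Δ)
    (hSlater : ∃ x : Fin n → ℝ, x ⬝ᵥ x < Δ ∧ b ⬝ᵥ x < c) {t l : ℝ}
    (hopt : IsEigOptimal A a b c Δ t l) {y : Fin n → ℝ}
    (hmin : ∀ x ∈ feasible b c Δ, convexified A a Δ y ≤ convexified A a Δ x) :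
    convexified A a Δ y ≤ k A a b c Δ t l := by
  obtain ⟨μ₁, μ₂, h1, h2, hμ⟩ := exists_multipliers (convexOn_convexified hA a Δ)
    (convexOn_dotProduct_self_sub Δ) (convexOn_dotProduct_sub b c)
    (fun x hx1 hx2 => hmin x ⟨sub_nonpos.mp hx1, sub_nonpos.mp hx2⟩)
    (hSlater.imp fun x hx => ⟨sub_neg.mpr hx.1, sub_neg.mpr hx.2⟩)
  have hpos : ∀ x, 0 ≤ x ⬝ᵥ A *ᵥ x + (μ₁ - lambdaMin A) * (x ⬝ᵥ x) := by
    intro x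
    have h3 := (lambdaMin_spec hA).2 x
    have h4 := mul_nonneg h1 (dotProduct_self_nonneg x)
    linarith
  -- Taking l₁ = μ₁ - λ_min(A) turns the Lagrangian of the convexified problem into the original
  -- one.
  have hlag : ∀ x, convexified A a Δ y ≤ lagrangian A a b c Δ (μ₁ - lambdaMin A) μ₂ x := by
    intro x
    rw [lagrangian_eq_convexified, sub_add_cancel]
    exact hμ x
  obtain ⟨t', ht'⟩ := exists_le_k hA hpos hlag hΔ
  have hmem : (t', μ₂) ∈ eigFeasible A a b :=
    ⟨h2, (lambdaMin_D_le hA t' μ₂).trans (lambdaMin_nonpos hA hpd)⟩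
  have hle : k A a b c Δ t' μ₂ ≤ k A a b c Δ t l := by
    have := isMaxOn_iff.mp hopt.2 (t', μ₂) hmem
    simpa only using this
  exact le_trans ht' hle

/-! ### Stationary points and the eigenspace of λ_min -/

theorem mulVec_eq_of_isMin_lagrangian (hA : A.IsSymm) {l₁ l₂ : ℝ} {y : Fin n → ℝ}
    (h : ∀ x, lagrangian A a b c Δ l₁ l₂ y ≤ lagrangian A a b c Δ l₁ l₂ x) :
    (A - (-l₁) • (1 : Matrix (Fin n) (Fin n) ℝ)) *ᵥ y = a - (l₂ / 2) • b := by
  refine mulVec_eq_of_isMin (isSymm_sub_smul_one hA _) _ _ fun x => ?_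
  have := h x
  rw [lagrangian_eq, lagrangian_eq] at this
  simp only [sub_smul_one_mulVec, dotProduct_sub, sub_dotProduct, dotProduct_smul, smul_eq_mul,
    smul_dotProduct, add_dotProduct, neg_dotProduct] at this ⊢
  linarith

/-- On a line inside the eigenspace of `λ_min`, through a solution of the stationarity equation, the
convexified objective is affine with slope given by the linear constraint. -/
theorem convexified_add_smul (hA : A.IsSymm) {l : ℝ} {y u : Fin n → ℝ}
    (hy : (A - lambdaMin A • (1 : Matrix (Fin n) (Fin n) ℝ)) *ᵥ y = a - (l / 2) • b)
    (hu : A *ᵥ u = lambdaMin A • u) (s : ℝ) :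
    convexified A a Δ (y + s • u) = convexified A a Δ y - l * (s * (b ⬝ᵥ u)) := by
  have h1 : u ⬝ᵥ A *ᵥ y = lambdaMin A * (y ⬝ᵥ u) := by
    rw [dotProduct_mulVec_symm hA, hu, dotProduct_smul, smul_eq_mul]
  have h2 := congrArg (u ⬝ᵥ ·) hy
  simp only [sub_smul_one_mulVec, dotProduct_sub, dotProduct_smul, smul_eq_mul, h1] at h2
  rw [dotProduct_comm u y, dotProduct_comm u a, dotProduct_comm u b] at h2
  rw [convexified, objective, quadratic_add_smul hA, norm_add_smul, h1, hu, convexified, objective]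
  simp only [dotProduct_add, dotProduct_smul, smul_eq_mul]
  linear_combination 2 * s * h2

/-- The functional b is injective on the eigenspace, which is nonzero, so its dimension is one. -/
theorem multiplicity_eq_one [NeZero n] (hA : A.IsSymm)
    (h : ∀ u, A *ᵥ u = lambdaMin A • u → b ⬝ᵥ u = 0 → u = 0) :
    multiplicity A (lambdaMin A) = 1 := by
  obtain ⟨⟨u, hu, he⟩, -⟩ := lambdaMin_spec hA
  have hu0 : u ≠ 0 := by
    rintro rfl
    simp at hu
  have hbu : b ⬝ᵥ u ≠ 0 := fun h0 => hu0 (h u he h0)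
  refine finrank_eq_one_iff'.mpr ⟨⟨u, (mem_eigenspace_toLin' _ _ _).mpr he⟩, ?_, ?_⟩
  · simpa using hu0
  · rintro ⟨w, hw⟩
    rw [mem_eigenspace_toLin'] at hw
    refine ⟨(b ⬝ᵥ w) / (b ⬝ᵥ u), Subtype.ext ?_⟩
    refine (sub_eq_zero.mp (h (w - ((b ⬝ᵥ w) / (b ⬝ᵥ u)) • u) ?_ ?_)).symm
    · rw [Matrix.mulVec_sub, Matrix.mulVec_smul, hw, he]
      module
    · rw [dotProduct_sub, dotProduct_smul, smul_eq_mul, div_mul_cancel₀ _ hbu, sub_self]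

/-- When the eigenspace is a line, the equation `(A - μI)x = v` has at most two solutions on a
sphere. -/
theorem eq_or_eq_of_multiplicity_one {μ : ℝ} (hμ : multiplicity A μ = 1) {v x₁ x₂ y : Fin n → ℝ}
    (h₁ : (A - μ • (1 : Matrix (Fin n) (Fin n) ℝ)) *ᵥ x₁ = v)
    (h₂ : (A - μ • (1 : Matrix (Fin n) (Fin n) ℝ)) *ᵥ x₂ = v)
    (hy : (A - μ • (1 : Matrix (Fin n) (Fin n) ℝ)) *ᵥ y = v) (hne : x₁ ≠ x₂)
    (hn₁ : x₁ ⬝ᵥ x₁ = Δ) (hn₂ : x₂ ⬝ᵥ x₂ = Δ) (hny : y ⬝ᵥ y = Δ) : y = x₁ ∨ y = x₂ := by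
  have hmem : ∀ x, (A - μ • (1 : Matrix (Fin n) (Fin n) ℝ)) *ᵥ x = v →
      x - x₁ ∈ Module.End.eigenspace (Matrix.toLin' A) μ := by
    intro x hx
    have : (A - μ • (1 : Matrix (Fin n) (Fin n) ℝ)) *ᵥ (x - x₁) = 0 := by
      rw [Matrix.mulVec_sub, hx, h₁, sub_self]
    rwa [sub_smul_one_mulVec, sub_eq_zero, ← mem_eigenspace_toLin'] at this
  have hd : x₂ - x₁ ≠ 0 := sub_ne_zero.mpr hne.symm
  obtain ⟨s, hs⟩ := exists_smul_eq_of_finrank_eq_one hμ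
    (x := ⟨x₂ - x₁, hmem x₂ h₂⟩) (by simpa using hd) ⟨y - x₁, hmem y hy⟩
  have hs' : s • (x₂ - x₁) = y - x₁ := congrArg Subtype.val hs
  have ey : y = x₁ + s • (x₂ - x₁) := by rw [hs']; abel
  have e₂ : x₂ = x₁ + (1 : ℝ) • (x₂ - x₁) := by module
  have k₂ := norm_add_smul x₁ (x₂ - x₁) 1
  have ky := norm_add_smul x₁ (x₂ - x₁) s
  rw [← e₂, hn₂, hn₁] at k₂
  rw [← ey, hny, hn₁] at ky
  -- The sphere equation along the line is quadratic in s and has the roots 0 and 1.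
  have hz : s * (s - 1) * ((x₂ - x₁) ⬝ᵥ (x₂ - x₁)) = 0 := by
    linear_combination s * k₂ - ky
  rcases mul_eq_zero.mp hz with hz | hz
  · rcases mul_eq_zero.mp hz with hz | hz
    · left
      rw [ey, hz, zero_smul, add_zero]
    · right
      obtain rfl : s = 1 := by linarith
      rw [ey]
      exact e₂.symm
  · exact absurd (dotProduct_self_eq_zero.mp hz) hd

/-- If the minimizer of the convexified problem yields no feasible point of equal objective value,
then the multiplier of the linear constraint is positive, and the eigenspace of `λ_min` is a line
meeting the constraint transversally. -/
theorem exists_two_solutions [NeZero n] (hA : A.IsSymm) {l : ℝ} (hl : 0 ≤ l) {y : Fin n → ℝ}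
    (hy : y ∈ feasible b c Δ) (hylt : y ⬝ᵥ y < Δ) (hyc : l * (b ⬝ᵥ y - c) = 0)
    (hstat : (A - lambdaMin A • (1 : Matrix (Fin n) (Fin n) ℝ)) *ᵥ y = a - (l / 2) • b)
    (hno : ∀ z ∈ feasible b c Δ, convexified A a Δ y < objective A a z) :
    0 < l ∧ multiplicity A (lambdaMin A) = 1 ∧ ∃ x₁ x₂ : Fin n → ℝ,
      (A - lambdaMin A • (1 : Matrix (Fin n) (Fin n) ℝ)) *ᵥ x₁ = a - (l / 2) • b ∧
      (A - lambdaMin A • (1 : Matrix (Fin n) (Fin n) ℝ)) *ᵥ x₂ = a - (l / 2) • b ∧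
      x₁ ⬝ᵥ x₁ = Δ ∧ x₂ ⬝ᵥ x₂ = Δ ∧ (b ⬝ᵥ x₁ - c) * (b ⬝ᵥ x₂ - c) < 0 := by
  -- Otherwise one could follow u to the sphere, staying feasible at constant convexified value, and
  -- contradict `hno`.
  have hmove : ∀ u, u ≠ 0 → A *ᵥ u = lambdaMin A • u → b ⬝ᵥ u ≤ 0 → l * (b ⬝ᵥ u) ≠ 0 := by
    intro u hu0 hu hbu hl0
    obtain ⟨s, hs, hns⟩ := exists_pos_norm_eq hylt hu0
    have h1 : y + s • u ∈ feasible b c Δ := by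
      refine ⟨hns.le, ?_⟩
      rw [dotProduct_add, dotProduct_smul, smul_eq_mul]
      nlinarith [hy.2]
    have h2 := hno _ h1
    have h3 := convexified_add_smul (Δ := Δ) hA hstat hu s
    rw [show l * (s * (b ⬝ᵥ u)) = s * (l * (b ⬝ᵥ u)) by ring, hl0, convexified, hns] at h3
    linarith
  obtain ⟨⟨u, hu1, hu⟩, -⟩ := lambdaMin_spec hA
  have hu0 : u ≠ 0 := by
    rintro rfl
    simp at hu1
  have hun : A *ᵥ (-u) = lambdaMin A • (-u) := by rw [Matrix.mulVec_neg, hu, smul_neg]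
  have hlpos : 0 < l := by
    refine lt_of_le_of_ne hl fun h0 => ?_
    rcases le_total (b ⬝ᵥ u) 0 with h | h
    · exact hmove u hu0 hu h (by rw [← h0, zero_mul])
    · exact hmove (-u) (neg_ne_zero.mpr hu0) hun (by rwa [dotProduct_neg, neg_nonpos])
        (by rw [← h0, zero_mul])
  have hker : ∀ w, A *ᵥ w = lambdaMin A • w → b ⬝ᵥ w = 0 → w = 0 := by
    intro w hw hbw
    by_contra hw0
    exact hmove w hw0 hw hbw.le (by rw [hbw, mul_zero])
  have hbu : b ⬝ᵥ u ≠ 0 := fun h => hu0 (hker u hu h)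
  have hbc : b ⬝ᵥ y - c = 0 := (mul_eq_zero.mp hyc).resolve_left hlpos.ne'
  obtain ⟨s, hs, hns⟩ := exists_pos_norm_eq hylt hu0
  obtain ⟨r, hr, hnr⟩ := exists_pos_norm_eq hylt (neg_ne_zero.mpr hu0)
  have hsol : ∀ (q : ℝ) (w : Fin n → ℝ), A *ᵥ w = lambdaMin A • w →
      (A - lambdaMin A • (1 : Matrix (Fin n) (Fin n) ℝ)) *ᵥ (y + q • w) = a - (l / 2) • b := by
    intro q w hw
    rw [Matrix.mulVec_add, Matrix.mulVec_smul, hstat, sub_smul_one_mulVec, hw, sub_self,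
      smul_zero, add_zero]
  refine ⟨hlpos, multiplicity_eq_one hA hker, y + s • u, y + r • -u, hsol s u hu, hsol r _ hun,
    hns, hnr, ?_⟩
  -- As bᵀy = c, the two factors are s bᵀu and -r bᵀu with s, r > 0.
  have h1 : (b ⬝ᵥ (y + s • u) - c) * (b ⬝ᵥ (y + r • -u) - c) = -(s * r * (b ⬝ᵥ u) ^ 2) := by
    simp only [dotProduct_add, dotProduct_smul, dotProduct_neg, smul_eq_mul]
    linear_combination (b ⬝ᵥ y - c + s * (b ⬝ᵥ u) - r * (b ⬝ᵥ u)) * hbc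
  rw [h1, neg_lt_zero]
  positivity

end ETRS

end ETRS

/-! ### The characterization of failure -/

open ETRS

theorem corollary1 {n : ℕ} (A : Matrix (Fin n) (Fin n) ℝ) (hA : A.IsSymm) (hpd : ¬ A.PosDef)
    (a b : Fin n → ℝ) (c Δ : ℝ) (hΔ : 0 < Δ)
    (hSlater : ∃ x : Fin n → ℝ, x ⬝ᵥ x < Δ ∧ b ⬝ᵥ x < c)
    (t l : ℝ) (hopt : ETRS.IsEigOptimal A a b c Δ t l) :
    ¬ ETRS.StrongDuality A a b c Δ ↔
      (ETRS.lambdaMin (ETRS.D A a b t l) = ETRS.lambdaMin A ∧ ETRS.lambdaMin A < 0 ∧ 0 < l) ∧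
      (ETRS.multiplicity A (ETRS.lambdaMin A) = 1 ∧
        ∃ x₁ x₂ : Fin n → ℝ,
          (A - ETRS.lambdaMin A • (1 : Matrix (Fin n) (Fin n) ℝ)) *ᵥ x₁ = a - (l / 2) • b ∧
          (A - ETRS.lambdaMin A • (1 : Matrix (Fin n) (Fin n) ℝ)) *ᵥ x₂ = a - (l / 2) • b ∧
          x₁ ⬝ᵥ x₁ = Δ ∧ x₂ ⬝ᵥ x₂ = Δ ∧
          (b ⬝ᵥ x₁ - c) * (b ⬝ᵥ x₂ - c) < 0) := by
  -- The empty matrix is positive definite, so `hpd` excludes n = 0.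
  have hn : NeZero n := ⟨by
    rintro rfl
    refine hpd (Matrix.PosDef.of_dotProduct_mulVec_pos ?_ fun x hx => ?_)
    · ext i
      exact i.elim0
    · exact absurd (Subsingleton.elim x 0) hx⟩
  obtain ⟨y, hy, hmin⟩ := exists_isMin_convexified A a hSlater
  have hk := convexified_le_k hA hpd hΔ hSlater hopt hmin
  have hl : 0 ≤ l := hopt.1.1
  have hD : lambdaMin (D A a b t l) ≤ 0 := hopt.1.2
  have hDA : lambdaMin (D A a b t l) ≤ lambdaMin A := lambdaMin_D_le hA t l
  have hlag : ∀ x, convexified A a Δ y ≤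
      lagrangian A a b c Δ (-lambdaMin (D A a b t l)) l x :=
    fun x => hk.trans (k_le_lagrangian hA t l x)
  set σ := lambdaMin (D A a b t l) with hσ
  constructor
  · intro hSD
    have hno : ∀ z ∈ feasible b c Δ, convexified A a Δ y < objective A a z := by
      intro z hz
      by_contra! h
      exact hSD (strongDuality_of_le (neg_nonneg.mpr hD) hl hlag hz h)
    have hylt : y ⬝ᵥ y < Δ := by
      refine lt_of_le_of_ne hy.1 fun h => ?_
      have := hno y hy
      rw [convexified, h, sub_self, mul_zero, add_zero] at this
      exact lt_irrefl _ this
    have hneg : lambdaMin A < 0 := by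
      refine lt_of_le_of_ne (lambdaMin_nonpos hA hpd) fun h => ?_
      have := hno y hy
      rw [convexified, h, zero_mul, add_zero] at this
      exact lt_irrefl _ this
    have hy1 := hlag y
    rw [lagrangian_eq_convexified] at hy1
    have hp1 := mul_nonneg (sub_nonneg.mpr hDA) (sub_nonneg.mpr hy.1)
    have hp2 := mul_nonneg hl (sub_nonneg.mpr hy.2)
    -- At y the Lagrangian is the minimum plus two nonpositive terms, but is at least the minimum,
    -- so both vanish.
    have hc1 : (lambdaMin A - σ) * (Δ - y ⬝ᵥ y) = 0 := by linarith
    have hc2 : l * (b ⬝ᵥ y - c) = 0 := by linarith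
    have heq : σ = lambdaMin A := by
      rcases mul_eq_zero.mp hc1 with h | h <;> linarith
    have hstat := mulVec_eq_of_isMin_lagrangian (y := y) hA fun x =>
      le_trans (le_of_eq (by rw [lagrangian_eq_convexified]; linarith)) (hlag x)
    rw [neg_neg, heq] at hstat
    obtain ⟨h1, h2, h3⟩ := exists_two_solutions hA hl hy hylt hc2 hstat hno
    exact ⟨⟨heq, hneg, h1⟩, h2, h3⟩
  · rintro ⟨⟨heq, hneg, hlpos⟩, hmul, x₁, x₂, hx₁, hx₂, hn₁, hn₂, hprod⟩ hSD
    obtain ⟨z, hz, hzo⟩ := exists_objective_le_of_strongDuality ⟨y, hy⟩ hSD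
      fun l₁ l₂ _ h₂ => exists_lagrangian_le_convexified hA hy l₁ h₂
    have hz1 := hlag z
    rw [lagrangian, heq] at hz1
    have hp1 := mul_nonneg (neg_nonneg.mpr hneg.le) (sub_nonneg.mpr hz.1)
    have hp2 := mul_nonneg hl (sub_nonneg.mpr hz.2)
    -- At z the Lagrangian is squeezed between the convexified minimum and the objective, so both
    -- slackness terms vanish; their multipliers are positive.
    have hzΔ : z ⬝ᵥ z = Δ := by
      have : -lambdaMin A * (Δ - z ⬝ᵥ z) = 0 := by linarith
      rcases mul_eq_zero.mp this with h | h <;> linarith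
    have hzc : b ⬝ᵥ z = c := by
      have : l * (c - b ⬝ᵥ z) = 0 := by linarith
      rcases mul_eq_zero.mp this with h | h <;> linarith
    have hstat := mulVec_eq_of_isMin_lagrangian (y := z) hA fun x =>
      le_trans ((lagrangian_le_objective (neg_nonneg.mpr hD) hl hz).trans hzo) (hlag x)
    rw [neg_neg, heq] at hstat
    have hne : x₁ ≠ x₂ := by
      rintro rfl
      exact absurd hprod (not_lt.mpr (mul_self_nonneg _))
    rcases eq_or_eq_of_multiplicity_one hmul hx₁ hx₂ hstat hne hn₁ hn₂ hzΔ with rfl | rfl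
    · rw [hzc, sub_self, zero_mul] at hprod
      exact lt_irrefl _ hprod
    · rw [hzc, sub_self, mul_zero] at hprod
      exact lt_irrefl _ hprod
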